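/- Let $X$ and $Y$ be real Banach spaces, let $Z\subseteq Y$ be a closed subspace, and let $T\colon X\to Y$ be a bounded linear operator with biadjoint $T^{**}\colon X^{**}\to Y^{**}$. Let $X^{**}_1$ be the closed unit ball of $X^{**}$, let $Z^{\perp\perp}=\{F\in Y^{**}: F(g)=0 \text{ for every } g\in Y^* \text{ that vanishes on } Z\}$, and let $d(F,Z^{\perp\perp})=\inf_{G\in Z^{\perp\perp}}\|F-G\|$ for $F\in Y^{**}$. Suppose that there is a $\Lambda\in X^{**}_1$ such that $$\|T^{**}(\Lambda)\|=\|T^{**}\|\quad\text{and}\quad d(T^{**}(\Lambda),Z^{\perp\perp})=\sup_{\tau\in X^{**}_1}d(T^{**}(\tau),Z^{\perp\perp}).$$ Then there is an extreme point $\Lambda$ of $X^{**}_1$ that satisfies the same two conditions. -/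

import Mathlib

set_option maxSynthPendingDepth 3

/-- The adjoint `T* : Y* → X*`, `T* g = g ∘ T`, of a bounded operator `T : X → Y` between real
normed spaces. -/
noncomputable def banachAdjoint {X Y : Type*} [NormedAddCommGroup X] [NormedSpace ℝ X]
    [NormedAddCommGroup Y] [NormedSpace ℝ Y] (T : X →L[ℝ] Y) :
    StrongDual ℝ Y →L[ℝ] StrongDual ℝ X :=
  ContinuousLinearMap.precomp ℝ T

/-- The biadjoint `T** : X** → Y**` of a bounded operator `T : X → Y`. -/
noncomputable def biadjoint {X Y : Type*} [NormedAddCommGroup X] [NormedSpace ℝ X]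
    [NormedAddCommGroup Y] [NormedSpace ℝ Y] (T : X →L[ℝ] Y) :
    StrongDual ℝ (StrongDual ℝ X) →L[ℝ] StrongDual ℝ (StrongDual ℝ Y) :=
  banachAdjoint (banachAdjoint T)

/-- The second annihilator `Z^⊥⊥ ⊆ Y**` of a subspace `Z ⊆ Y`: the functionals on `Y*` that vanish
on `Z^⊥`. On subspaces, `StrongDual.polarSubmodule` is the annihilator. -/
noncomputable def biannihilator {Y : Type*} [NormedAddCommGroup Y] [NormedSpace ℝ Y]
    (Z : Submodule ℝ Y) : Submodule ℝ (StrongDual ℝ (StrongDual ℝ Y)) :=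
  StrongDual.polarSubmodule ℝ (StrongDual.polarSubmodule ℝ Z)

/-! The points of the ball where both suprema are attained form an extreme set, but it need not be
weak* closed, so Krein–Milman does not apply to it directly. Instead take `y n` in the ball of `Y*`
and `z n` in the ball of `Z^⊥` that nearly attain the norm and the distance at `Λ`, with errors
below `2⁻ⁿ`. The deficits `‖T**‖ + D - τ (T* (y n + z n))` are nonnegative, weak* continuous and
affine in `τ`, and summable at `Λ`. Their sum is affine and lower semicontinuous, so its minimizers
form a nonempty compact face, which has an extreme point `e`. The deficits at `e` tend to 0, which
forces both equalities. -/

/-- A summable family of affine functions that are nonnegative on a compact set: if it is summable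
at one point of the set, then it is summable at an extreme point. -/
theorem IsCompact.exists_extremePoint_summable {ι E : Type*} [AddCommGroup E] [Module ℝ E]
    [TopologicalSpace E] [T2Space E] [IsTopologicalAddGroup E] [ContinuousSMul ℝ E]
    [LocallyConvexSpace ℝ E] {K : Set E} (hK : IsCompact K) (φ : ι → E →L[ℝ] ℝ) (c : ι → ℝ)
    (hφ : ∀ i, ∀ x ∈ K, φ i x ≤ c i) {x₀ : E} (hx₀ : x₀ ∈ K)
    (hs : Summable fun i => c i - φ i x₀) :
    ∃ e ∈ K.extremePoints ℝ, Summable fun i => c i - φ i e := by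
  set h : E → ENNReal := fun x => ∑' i, ENNReal.ofReal (c i - φ i x)
  have hlsc : LowerSemicontinuous h := lowerSemicontinuous_tsum fun i =>
    (ENNReal.continuous_ofReal.comp (by fun_prop)).lowerSemicontinuous
  obtain ⟨m, hmK, hm⟩ := (hlsc.lowerSemicontinuousOn K).exists_isMinOn ⟨x₀, hx₀⟩ hK
  have hmin : ∀ x ∈ K, h m ≤ h x := fun x hx => hm hx
  have hfin : h m ≠ ⊤ := ne_top_of_le_ne_top hs.tsum_ofReal_ne_top (hmin x₀ hx₀)
  have hface : IsExtreme ℝ K (K ∩ h ⁻¹' Set.Iic (h m)) := by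
    refine ⟨Set.inter_subset_left, ?_⟩
    rintro x hx y hy z ⟨-, hz⟩ ⟨a, b, ha, hb, hab, rfl⟩
    refine ⟨hx, ?_⟩
    have haff : h (a • x + b • y) = ENNReal.ofReal a * h x + ENNReal.ofReal b * h y := by
      simp only [h, ← ENNReal.tsum_mul_left, ← ENNReal.tsum_add]
      refine tsum_congr fun i => ?_
      have hxi := sub_nonneg.2 (hφ i x hx)
      have hyi := sub_nonneg.2 (hφ i y hy)
      rw [← ENNReal.ofReal_mul ha.le, ← ENNReal.ofReal_mul hb.le,
        ← ENNReal.ofReal_add (by positivity) (by positivity)]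
      congr 1
      simp only [map_add, map_smul, smul_eq_mul]
      linear_combination -c i * hab
    -- Minimality at `y` reduces the claim to cancelling `b * h m`, which needs `h m` finite.
    have hle : ENNReal.ofReal a * h x + ENNReal.ofReal b * h m
        ≤ ENNReal.ofReal a * h m + ENNReal.ofReal b * h m := by
      calc _ ≤ ENNReal.ofReal a * h x + ENNReal.ofReal b * h y := by gcongr; exact hmin y hy
        _ ≤ h m := haff ▸ hz
        _ = _ := by rw [← add_mul, ← ENNReal.ofReal_add ha.le hb.le, hab, ENNReal.ofReal_one,
          one_mul]
    have hle' := (ENNReal.add_le_add_iff_right (ENNReal.mul_ne_top ENNReal.ofReal_ne_top hfin)).1 hle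
    exact (ENNReal.mul_le_mul_iff_right (by simpa using ha) ENNReal.ofReal_ne_top).1 hle'
  obtain ⟨e, he⟩ := (hK.inter_right (hlsc.isClosed_preimage (h m))).extremePoints_nonempty
    ⟨m, hmK, le_refl (h m)⟩
  have heK := hface.extremePoints_subset_extremePoints he
  refine ⟨e, heK, ?_⟩
  have hefin : h e ≠ ⊤ := ne_top_of_le_ne_top hfin he.1.2
  refine (ENNReal.summable_toReal hefin).congr fun i => ?_
  exact ENNReal.toReal_ofReal (sub_nonneg.2 (hφ i e heK.1))

/-- The version of `IsCompact.exists_extremePoint_summable` for the unit ball of a dual space. -/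
theorem StrongDual.exists_extremePoint_summable {ι E : Type*} [NormedAddCommGroup E]
    [NormedSpace ℝ E] (x : ι → E) (c : ι → ℝ)
    (hx : ∀ i, ∀ f ∈ Metric.closedBall (0 : StrongDual ℝ E) 1, f (x i) ≤ c i)
    {f₀ : StrongDual ℝ E} (hf₀ : f₀ ∈ Metric.closedBall (0 : StrongDual ℝ E) 1)
    (hs : Summable fun i => c i - f₀ (x i)) :
    ∃ e ∈ (Metric.closedBall (0 : StrongDual ℝ E) 1).extremePoints ℝ,
      Summable fun i => c i - e (x i) := by
  let φ : ι → WeakDual ℝ E →L[ℝ] ℝ := fun i =>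
    { toFun := fun f => f (x i)
      map_add' := fun _ _ => rfl
      map_smul' := fun _ _ => rfl
      cont := WeakDual.eval_continuous (x i) }
  have : LocallyConvexSpace ℝ (WeakDual ℝ E) :=
    WeakBilin.locallyConvexSpace (B := topDualPairing ℝ E)
  obtain ⟨e, he, hes⟩ := (WeakDual.isCompact_closedBall (𝕜 := ℝ) (0 : StrongDual ℝ E)
    1).exists_extremePoint_summable φ c
    (fun i f hf => hx i (WeakDual.toStrongDual f) hf) (x₀ := StrongDual.toWeakDual f₀) hf₀ hs
  -- Extremality is algebraic, so it does not depend on the topology.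
  refine ⟨WeakDual.toStrongDual e, ⟨he.1, fun f hf g hg hfg => ?_⟩, hes⟩
  exact he.2 (x₁ := StrongDual.toWeakDual f) hf (x₂ := StrongDual.toWeakDual g) hg hfg

/-- The norm of the restriction of a functional to a subspace is approximated by its values on the
unit ball of the subspace. -/
theorem StrongDual.exists_mem_lt_apply {E : Type*} [NormedAddCommGroup E] [NormedSpace ℝ E]
    (W : Submodule ℝ E) (F : StrongDual ℝ E) {r : ℝ} (hr : r < ‖F.comp W.subtypeL‖) :
    ∃ g ∈ W, ‖g‖ ≤ 1 ∧ r < F g := by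
  obtain ⟨g, hg, hrg⟩ := (F.comp W.subtypeL).exists_lt_apply_of_lt_opNorm hr
  rcases lt_abs.1 (Real.norm_eq_abs _ ▸ hrg) with h | h
  · exact ⟨g, g.2, hg.le, h⟩
  · exact ⟨-g, W.neg_mem g.2, by simpa using hg.le, by simpa using h⟩

/-- Values of a functional on the unit ball of a subspace are bounded by the distance to the
annihilator of the subspace. -/
theorem StrongDual.apply_le_infDist_polarSubmodule {E : Type*} [NormedAddCommGroup E]
    [NormedSpace ℝ E] (W : Submodule ℝ E) (F : StrongDual ℝ E) {g : E} (hg : g ∈ W)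
    (hg1 : ‖g‖ ≤ 1) : F g ≤ Metric.infDist F (StrongDual.polarSubmodule ℝ W : Set _) := by
  refine (Metric.le_infDist ⟨0, Submodule.zero_mem _⟩).2 fun G hG => ?_
  have hGg : G g = 0 := (StrongDual.mem_polarSubmodule ℝ W G).1 hG g hg
  calc F g = (F - G) g := by simp [hGg]
    _ ≤ ‖(F - G) g‖ := Real.le_norm_self _
    _ ≤ ‖F - G‖ := (F - G).unit_le_opNorm g hg1
    _ = dist F G := (dist_eq_norm F G).symm

/-- Hahn–Banach: a norm-preserving extension of the restriction to `W` differs from `F` by an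
element of the annihilator. -/
theorem StrongDual.infDist_polarSubmodule_le {E : Type*} [NormedAddCommGroup E]
    [NormedSpace ℝ E] (W : Submodule ℝ E) (F : StrongDual ℝ E) :
    Metric.infDist F (StrongDual.polarSubmodule ℝ W : Set _) ≤ ‖F.comp W.subtypeL‖ := by
  obtain ⟨F', hF', hn⟩ := exists_extension_norm_eq W (F.comp W.subtypeL)
  have hmem : F - F' ∈ StrongDual.polarSubmodule ℝ W := by
    rw [StrongDual.mem_polarSubmodule]
    intro g hg
    have := hF' ⟨g, hg⟩
    simp_all
  calc _ ≤ dist F (F - F') := Metric.infDist_le_dist_of_mem hmem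
    _ = ‖F'‖ := by rw [dist_eq_norm, sub_sub_cancel]
    _ = _ := hn

theorem proposition4 {X Y : Type*}
    [NormedAddCommGroup X] [NormedSpace ℝ X] [CompleteSpace X]
    [NormedAddCommGroup Y] [NormedSpace ℝ Y] [CompleteSpace Y]
    (T : X →L[ℝ] Y) (Z : Submodule ℝ Y) (hZ : IsClosed (Z : Set Y))
    (hΛ : ∃ Λ ∈ Metric.closedBall (0 : StrongDual ℝ (StrongDual ℝ X)) 1,
      ‖biadjoint T Λ‖ = ‖biadjoint T‖ ∧
      IsLUB ((fun τ => Metric.infDist (biadjoint T τ) (biannihilator Z : Set _)) ''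
          Metric.closedBall (0 : StrongDual ℝ (StrongDual ℝ X)) 1)
        (Metric.infDist (biadjoint T Λ) (biannihilator Z : Set _))) :
    ∃ Λ ∈ Set.extremePoints ℝ (Metric.closedBall (0 : StrongDual ℝ (StrongDual ℝ X)) 1),
      ‖biadjoint T Λ‖ = ‖biadjoint T‖ ∧
      IsLUB ((fun τ => Metric.infDist (biadjoint T τ) (biannihilator Z : Set _)) ''
          Metric.closedBall (0 : StrongDual ℝ (StrongDual ℝ X)) 1)
        (Metric.infDist (biadjoint T Λ) (biannihilator Z : Set _)) := by
  obtain ⟨Λ, hΛ1, hN, hD⟩ := hΛ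
  set W := StrongDual.polarSubmodule ℝ Z
  set D := Metric.infDist (biadjoint T Λ) (biannihilator Z : Set _) with hDdef
  have hpos : ∀ n : ℕ, (0 : ℝ) < (1 / 2) ^ n := fun n => by positivity
  have hnorm_top : ‖biadjoint T Λ‖ ≤
      ‖(biadjoint T Λ).comp (⊤ : Submodule ℝ (StrongDual ℝ Y)).subtypeL‖ :=
    ContinuousLinearMap.opNorm_le_bound _ (norm_nonneg _) fun g =>
      ((biadjoint T Λ).comp (⊤ : Submodule ℝ (StrongDual ℝ Y)).subtypeL).le_opNorm
        ⟨g, Submodule.mem_top⟩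
  have hy : ∀ n : ℕ, ∃ g : StrongDual ℝ Y, ‖g‖ ≤ 1 ∧
      ‖biadjoint T‖ - (1 / 2) ^ n < biadjoint T Λ g := fun n => by
    obtain ⟨g, -, hg⟩ := StrongDual.exists_mem_lt_apply ⊤ (biadjoint T Λ)
      (r := ‖biadjoint T‖ - (1 / 2) ^ n) (by linarith [hpos n])
    exact ⟨g, hg⟩
  have hz : ∀ n : ℕ, ∃ g ∈ W, ‖g‖ ≤ 1 ∧ D - (1 / 2) ^ n < biadjoint T Λ g := fun n =>
    StrongDual.exists_mem_lt_apply W (biadjoint T Λ) (by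
      have : D ≤ _ := StrongDual.infDist_polarSubmodule_le W (biadjoint T Λ)
      linarith [hpos n])
  choose y hy1 hyΛ using hy
  choose z hzW hz1 hzΛ using hz
  have hyle : ∀ τ n, biadjoint T τ (y n) ≤ ‖biadjoint T τ‖ := fun τ n =>
    (Real.le_norm_self _).trans ((biadjoint T τ).unit_le_opNorm _ (hy1 n))
  have hzle : ∀ τ n, biadjoint T τ (z n) ≤
      Metric.infDist (biadjoint T τ) (biannihilator Z : Set _) := fun τ n =>
    StrongDual.apply_le_infDist_polarSubmodule W _ (hzW n) (hz1 n)
  have hNle : ∀ τ ∈ Metric.closedBall (0 : StrongDual ℝ (StrongDual ℝ X)) 1,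
      ‖biadjoint T τ‖ ≤ ‖biadjoint T‖ := fun τ hτ =>
    (biadjoint T).unit_le_opNorm τ (mem_closedBall_zero_iff.1 hτ)
  have hDle : ∀ τ ∈ Metric.closedBall (0 : StrongDual ℝ (StrongDual ℝ X)) 1,
      Metric.infDist (biadjoint T τ) (biannihilator Z : Set _) ≤ D := fun τ hτ =>
    hD.1 ⟨τ, hτ, rfl⟩
  have happly : ∀ (τ : StrongDual ℝ (StrongDual ℝ X)) n,
      τ (banachAdjoint T (y n + z n)) = biadjoint T τ (y n) + biadjoint T τ (z n) :=
    fun τ n => (biadjoint T τ).map_add (y n) (z n)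
  obtain ⟨e, he, hes⟩ := StrongDual.exists_extremePoint_summable
    (fun n => banachAdjoint T (y n + z n)) (fun _ => ‖biadjoint T‖ + D)
    (fun n τ hτ => by
      rw [happly]
      linarith [hyle τ n, hzle τ n, hNle τ hτ, hDle τ hτ]) hΛ1
    (by
      refine Summable.of_nonneg_of_le (fun n => ?_) (fun n => ?_)
        (summable_geometric_two.mul_left 2)
      · rw [happly]
        linarith [hyle Λ n, hzle Λ n]
      · rw [happly]
        linarith [hyΛ n, hzΛ n])
  have hlim := hes.tendsto_atTop_zero
  have hNe : ‖biadjoint T‖ ≤ ‖biadjoint T e‖ := by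
    -- The `z n` term is at most `D`, so each deficit at `e` is at least `‖T**‖ - ‖T** e‖`.
    refine sub_nonpos.1 (ge_of_tendsto' hlim fun n => ?_)
    rw [happly]
    linarith [hyle e n, hzle e n, hDle e he.1]
  have hDe : D ≤ Metric.infDist (biadjoint T e) (biannihilator Z : Set _) := by
    refine sub_nonpos.1 (ge_of_tendsto' hlim fun n => ?_)
    rw [happly]
    linarith [hyle e n, hzle e n, hNle e he.1]
  exact ⟨e, he, (hNle e he.1).antisymm hNe, (hDle e he.1).antisymm hDe ▸ hD⟩
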